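/- Let $D\subset\mathbb R^n$ be a bounded domain (e.g. a bounded open interval in $\mathbb R$) and let $\mathcal L$ be a densely defined, self-adjoint, positive operator on $L^2(D)$ (real-valued functions) with compact inverse. Let $(e_j)_{j\ge1}$ be an orthonormal basis of $L^2(D)$ with $\mathcal L e_j=\lambda_j e_j$, $0<\lambda_1\le\lambda_2\le\dots$, and for $r>0$ let $$\mathcal H^r=\Big\{v\in L^2(D):\ \|v\|_{\mathcal H^r}^2:=\sum_j\lambda_j^{2r}\langle v,e_j\rangle^2<\infty\Big\}.$$ Let $Q$ be a bounded, self-adjoint, positive semidefinite operator on $L^2(D)$ with $Qe_j=\mu_je_j$ and $\operatorname{Tr}Q<\infty$. Let $T>0$, $s>0$, and assume the decay condition: for some $\varepsilon>0$ one has $\mu_j\sim\lambda_j^{-2s-\varepsilon}$ (i.e. the two sequences are comparable up to positive constants, for all large $j$), and $\sum_j\lambda_j^{-s}<\infty$. Let $y_0\in\mathcal H^{s/2}$ be deterministic. For a $Q$-Wiener process $W$ on $[0,T]$ with values in $L^2(D)$, on a probability space $(\Omega,\mathcal F,\mathbb P)$ and adapted to a normal filtration $(\mathcal F_t)$, put $B_j(t)=\mu_j^{-1/2}\langle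 W(t),e_j\rangle$ for $\mu_j>0$ (if $\mu_j=0$, the noise term $\sqrt{\mu_j}\,dB_j$ below is absent). A solution of $$dy(t)+\mathcal L^s y(t)\,dt=dW(t),\qquad y(0)=y_0,$$ on $[0,T]$ is an $(\mathcal F_t)$-adapted $L^2(D)$-valued process $y$ such that $y(t)\in L^2(\Omega;\mathcal H^s)$ for every $t\in(0,T]$ and, for every $j$, the process $y_j=\langle y,e_j\rangle$ has almost surely continuous paths and solves the Itô equation $$dy_j(t)=-\lambda_j^s\,y_j(t)\,dt+\sqrt{\mu_j}\,dB_j(t),\qquad y_j(0)=\langle y_0,e_j\rangle .$$ Then there is a constant $C>0$, depending only on $(e_j),(\lambda_j),(\mu_j),s,T,y_0$, such that, for all such $(\Omega,\mathcal F,\mathbb P)$, $(\mathcal F_t)$ and $W$, every solution $y$ belongs to $L^2(\Omega\times[0,T];\mathcal H^s)$ and $$\|y\|_{L^2(\Omega\times[0,T];\,\mathcal H^s)}\le C .$$ -/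

import Mathlib

open MeasureTheory ProbabilityTheory Filter Set
open scoped NNReal ENNReal

noncomputable section

/-- The real space `L²(D)` (Lebesgue measure on `D`). -/
abbrev L2 {E : Type*} [NormedAddCommGroup E] [InnerProductSpace ℝ E] [FiniteDimensional ℝ E]
    [MeasurableSpace E] [BorelSpace E] (D : Set E) : Type _ :=
  Lp ℝ 2 ((volume : Measure E).restrict D)

/-- `L²(D)` carries its Borel σ-algebra. -/
instance L2.measurableSpace {E : Type*} [NormedAddCommGroup E] [InnerProductSpace ℝ E]
    [FiniteDimensional ℝ E] [MeasurableSpace E] [BorelSpace E] (D : Set E) :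
    MeasurableSpace (L2 D) := borel _

instance L2.borelSpace {E : Type*} [NormedAddCommGroup E] [InnerProductSpace ℝ E]
    [FiniteDimensional ℝ E] [MeasurableSpace E] [BorelSpace E] (D : Set E) :
    BorelSpace (L2 D) := ⟨rfl⟩

namespace FracSPDE

/-! ### The operator, its eigenbasis and the spaces `ℋ^s` -/

/-- A densely defined, self-adjoint, positive, possibly unbounded operator with compact inverse. -/
structure IsPositiveWithCompactInverse {H : Type*} [NormedAddCommGroup H] [InnerProductSpace ℝ H]
    [CompleteSpace H] (A : H →ₗ.[ℝ] H) : Prop where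
  dense : Dense (A.domain : Set H)
  selfAdjoint : IsSelfAdjoint A
  pos : ∀ v : A.domain, v ≠ 0 → 0 < inner ℝ (A v) (v : H)
  compact_inverse : ∃ K : H →L[ℝ] H, IsCompactOperator K ∧
    (∀ u : H, ∃ h : K u ∈ A.domain, A ⟨K u, h⟩ = u) ∧ ∀ v : A.domain, K (A v) = v

/-- An orthonormal basis `(e_j)` of eigenvectors of `A`, with the eigenvalues
`0 < lam_0 ≤ lam_1 ≤ …` listed in nondecreasing order (indices start at `0`). -/
structure EigenSystem {H : Type*} [NormedAddCommGroup H] [InnerProductSpace ℝ H]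
    (A : H →ₗ.[ℝ] H) where
  e : HilbertBasis ℕ ℝ H
  lam : ℕ → ℝ
  pos : ∀ j, 0 < lam j
  mono : Monotone lam
  mem_domain : ∀ j, e j ∈ A.domain
  apply_eq : ∀ j, A ⟨e j, mem_domain j⟩ = lam j • e j

section Hs

variable {H : Type*} [NormedAddCommGroup H] [InnerProductSpace ℝ H] {A : H →ₗ.[ℝ] H}

/-- The weighted coordinates `(lam_j ^ s ⟨v, e_j⟩)_j` of `v`. -/
def wcoord (S : EigenSystem A) (s : ℝ) (v : H) (j : ℕ) : ℝ := S.lam j ^ s * inner ℝ v (S.e j)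

/-- `ℋ^s` as a subspace of `H`: the vectors `v` with `∑ lam_j ^ (2 s) ⟨v, e_j⟩² < ∞`. -/
def hsSubmodule (S : EigenSystem A) (s : ℝ) : Submodule ℝ H where
  carrier := {v | Memℓp (wcoord S s v) 2}
  zero_mem' := by
    have h : wcoord S s (0 : H) = 0 := by ext j; simp [wcoord]
    simpa only [Set.mem_ofPred_eq, h] using zero_memℓp
  add_mem' := by
    intro a b ha hb
    have h : wcoord S s (a + b) = wcoord S s a + wcoord S s b := by
      ext j; simp [wcoord, inner_add_left, mul_add]
    simpa only [Set.mem_ofPred_eq, h] using Memℓp.add ha hb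
  smul_mem' := by
    intro c a ha
    have h : wcoord S s (c • a) = c • wcoord S s a := by
      ext j; simp [wcoord, inner_smul_left]; ring
    simpa only [Set.mem_ofPred_eq, h] using Memℓp.const_smul ha c

theorem mem_hsSubmodule_iff (S : EigenSystem A) (s : ℝ) (v : H) :
    v ∈ hsSubmodule S s ↔ Summable fun j => S.lam j ^ (2 * s) * (inner ℝ v (S.e j)) ^ 2 := by
  change Memℓp (wcoord S s v) 2 ↔ _
  rw [memℓp_gen_iff (by norm_num)]
  refine summable_congr fun j => ?_
  have h : S.lam j ^ (2 * s) = (S.lam j ^ s) ^ 2 := by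
    rw [mul_comm, Real.rpow_mul (S.pos j).le]; norm_num
  rw [h, ← mul_pow]
  simp [wcoord, mul_pow]

/-- The normed space `ℋ^s` (a type of its own, since its norm is not the one of `H`). -/
def Hs (S : EigenSystem A) (s : ℝ) : Type _ := hsSubmodule S s

instance (S : EigenSystem A) (s : ℝ) : AddCommGroup (Hs S s) :=
  inferInstanceAs (AddCommGroup (hsSubmodule S s))

instance (S : EigenSystem A) (s : ℝ) : Module ℝ (Hs S s) :=
  inferInstanceAs (Module ℝ (hsSubmodule S s))

/-- The inclusion `ℋ^s ⊆ H`. -/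
def Hs.incl (S : EigenSystem A) (s : ℝ) : Hs S s →ₗ[ℝ] H := (hsSubmodule S s).subtype

/-- The weighted coordinates as a map `ℋ^s → ℓ²`. -/
def Hs.toLp (S : EigenSystem A) (s : ℝ) : Hs S s →ₗ[ℝ] lp (fun _ : ℕ => ℝ) 2 where
  toFun v := ⟨wcoord S s (Hs.incl S s v), v.2⟩
  map_add' a b := by
    ext j
    change wcoord S s (Hs.incl S s (a + b)) j =
      wcoord S s (Hs.incl S s a) j + wcoord S s (Hs.incl S s b) j
    simp [wcoord, inner_add_left, mul_add]
  map_smul' c a := by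
    ext j; simp [wcoord, inner_smul_left]; ring

theorem Hs.toLp_injective (S : EigenSystem A) (s : ℝ) : Function.Injective (Hs.toLp S s) := by
  rw [← LinearMap.ker_eq_bot, LinearMap.ker_eq_bot']
  intro v hv
  have h0 : ∀ j, inner ℝ (Hs.incl S s v) (S.e j) = 0 := by
    intro j
    have h : wcoord S s (Hs.incl S s v) j = 0 :=
      congrArg (fun f : lp (fun _ : ℕ => ℝ) 2 => (f : ℕ → ℝ) j) hv
    exact (mul_eq_zero.1 h).resolve_left (Real.rpow_pos_of_pos (S.pos j) s).ne'
  have h1 : Hs.incl S s v = 0 := by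
    apply S.e.repr.injective
    ext j
    rw [S.e.repr_apply_apply, real_inner_comm, h0 j]
    simp
  exact Subtype.ext h1

/-- The norm of `ℋ^s`, pulled back from `ℓ²`; see `Hs.norm_eq`. -/
instance (S : EigenSystem A) (s : ℝ) : NormedAddCommGroup (Hs S s) :=
  NormedAddCommGroup.induced (Hs S s) (lp (fun _ : ℕ => ℝ) 2) (Hs.toLp S s)
    (Hs.toLp_injective S s)

instance (S : EigenSystem A) (s : ℝ) : NormedSpace ℝ (Hs S s) :=
  NormedSpace.induced ℝ (Hs S s) (lp (fun _ : ℕ => ℝ) 2) (Hs.toLp S s)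

theorem Hs.norm_eq (S : EigenSystem A) (s : ℝ) (v : Hs S s) :
    ‖v‖ = (∑' j, S.lam j ^ (2 * s) * (inner ℝ (Hs.incl S s v) (S.e j)) ^ 2) ^ (1 / 2 : ℝ) := by
  change ‖Hs.toLp S s v‖ = _
  rw [lp.norm_eq_tsum_rpow (by norm_num)]
  congr 1
  · refine tsum_congr fun j => ?_
    have h : S.lam j ^ (2 * s) = (S.lam j ^ s) ^ 2 := by
      rw [mul_comm, Real.rpow_mul (S.pos j).le]; norm_num
    rw [h, ← mul_pow]
    simp [Hs.toLp, wcoord, mul_pow]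

end Hs

/-- The decay assumption: `mu_j ∼ lam_j ^ (-2 s - ε)` for some `ε > 0` (two-sided comparability),
and `∑ lam_j ^ (-s) < ∞`. -/
def DecayAssumption (lam mu : ℕ → ℝ) (s : ℝ) : Prop :=
  (∃ ε : ℝ, 0 < ε ∧ mu =Θ[atTop] fun j => lam j ^ (-2 * s - ε)) ∧
    Summable fun j => lam j ^ (-s)

/-- `Q` is a bounded, self-adjoint, positive semidefinite operator of finite trace that is
diagonal in the basis `e`, with eigenvalues `mu`. -/
structure IsDiagonalCovariance {H : Type*} [NormedAddCommGroup H] [InnerProductSpace ℝ H]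
    [CompleteSpace H] (e : HilbertBasis ℕ ℝ H) (Q : H →L[ℝ] H) (mu : ℕ → ℝ) : Prop where
  isPositive : Q.IsPositive
  apply_eq : ∀ j, Q (e j) = mu j • e j
  trace_finite : Summable fun j => inner ℝ (Q (e j)) (e j)

/-! ### The noise and the solutions

Processes and filtrations are indexed by `ℝ`, but only their values at times in `[0, T]` are ever
constrained or used. -/

/-- A normal filtration: right-continuous, and the σ-algebra at time `0` contains all null
events. -/
structure IsNormalFiltration {Ω : Type*} {mΩ : MeasurableSpace Ω} (P : Measure Ω)
    (ℱ : Filtration ℝ mΩ) : Prop where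
  rightCont : ℱ.IsRightContinuous
  null : ∀ N : Set Ω, MeasurableSet N → P N = 0 → MeasurableSet[ℱ 0] N

/-- `W` is a `Q`-Wiener process on `[0, T]` adapted to `ℱ`: it starts at `0`, has almost surely
continuous paths and independent increments, and `W t - W r` has the centered Gaussian law with
covariance operator `(t - r) Q`. -/
structure IsQWiener {H : Type*} [NormedAddCommGroup H] [InnerProductSpace ℝ H]
    [MeasurableSpace H] [BorelSpace H] {Ω : Type*} {mΩ : MeasurableSpace Ω} (P : Measure Ω)
    (ℱ : Filtration ℝ mΩ) (Q : H →L[ℝ] H) (T : ℝ) (W : ℝ → Ω → H) : Prop where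
  adapted : ∀ t ∈ Icc 0 T, StronglyMeasurable[ℱ t] (W t)
  zero : ∀ᵐ ω ∂P, W 0 ω = 0
  cont : ∀ᵐ ω ∂P, ContinuousOn (fun t => W t ω) (Icc 0 T)
  indep : HasIndepIncrements (fun t : Icc (0 : ℝ) T => W t) P
  law : ∀ r ∈ Icc 0 T, ∀ t ∈ Icc 0 T, r ≤ t → ∀ h : H,
    HasLaw (fun ω => inner ℝ (W t ω - W r ω) h)
      (gaussianReal 0 ((t - r) * inner ℝ (Q h) h).toNNReal) P

/-- The scalar Brownian motions `B_j(t) = mu_j ^ (-1/2) ⟨W(t), e_j⟩` of the expansion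
`W = ∑ √mu_j e_j B_j`. If `mu_j = 0`, then `B_j` does not occur in that expansion (here it
is `0`). -/
def brownianCoord {H : Type*} [NormedAddCommGroup H] [InnerProductSpace ℝ H] {Ω : Type*}
    (e : HilbertBasis ℕ ℝ H) (mu : ℕ → ℝ) (W : ℝ → Ω → H) (j : ℕ) (t : ℝ) (ω : Ω) : ℝ :=
  (√(mu j))⁻¹ * inner ℝ (W t ω) (e j)

/-- `Y` is a representative of the `H`-valued function `f` in the Bochner space `L²(m; ℋ^s)`. -/
def IsL2HsRep {H : Type*} [NormedAddCommGroup H] [InnerProductSpace ℝ H] {A : H →ₗ.[ℝ] H}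
    (S : EigenSystem A) (s : ℝ) {X : Type*} {mX : MeasurableSpace X} (m : Measure X)
    (f : X → H) (Y : X → Hs S s) : Prop :=
  (∀ᵐ x ∂m, Hs.incl S s (Y x) = f x) ∧ MemLp Y 2 m

/-- `y` is a solution on `[0, T]` of `dy + A^s y dt = dW`, `y(0) = y0`: it is adapted,
`y(t) ∈ L²(Ω; ℋ^s)` for `t ∈ (0, T]`, and the coordinates `y_j = ⟨y, e_j⟩` are strong solutions
(continuous, in integrated form) of `dy_j = -lam_j ^ s y_j dt + √mu_j dB_j`,
`y_j(0) = ⟨y0, e_j⟩`. -/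
structure IsSolution {H : Type*} [NormedAddCommGroup H] [InnerProductSpace ℝ H] {A : H →ₗ.[ℝ] H}
    (S : EigenSystem A) (mu : ℕ → ℝ) (s T : ℝ) (y0 : H) {Ω : Type*} {mΩ : MeasurableSpace Ω}
    (P : Measure Ω) (ℱ : Filtration ℝ mΩ) (W : ℝ → Ω → H) (y : ℝ → Ω → H) : Prop where
  adapted : ∀ t ∈ Icc 0 T, StronglyMeasurable[ℱ t] (y t)
  regular : ∀ t ∈ Ioc 0 T, ∃ Y : Ω → Hs S s, IsL2HsRep S s P (y t) Y
  ito : ∀ j, ∀ᵐ ω ∂P, ContinuousOn (fun t => inner ℝ (y t ω) (S.e j)) (Icc 0 T) ∧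
    ∀ t ∈ Icc 0 T, inner ℝ (y t ω) (S.e j) = inner ℝ y0 (S.e j)
      - S.lam j ^ s * (∫ τ in (0 : ℝ)..t, inner ℝ (y τ ω) (S.e j))
      + √(mu j) * brownianCoord S.e mu W j t ω

end FracSPDE

end

/-! In the eigenbasis the equation splits into scalar ones, `u = c - a ∫ u + N` with `a = lam_j ^
s`, `c = ⟨y0, e_j⟩` and `N = √mu_j B_j`. Integrating by parts in Duhamel's formula removes the
stochastic integral: `u t` equals `exp (-a t) (c + N t)` plus the average of the increments `N t - N
r` against the kernel `a exp (-a (t - r))`. This holds path by path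
(`eq_exp_mul_add_integral_increment`), so the only probabilistic input is `E (N t - N r)² = mu_j (t
- r)`.

The kernel has mass at most one and first moment at most `1 / a`, so Cauchy–Schwarz and Tonelli give
`E u(t)² ≤ 3 (exp (-2 a t) c² + 2 mu_j / a)`. Integrating over `[0, T]` and multiplying by the
squared weight `a²` leaves `(3/2) a c² + 6 T a mu_j`. The first terms are summable because `y0 ∈
ℋ^{s/2}`, the second because `lam_j ^ s mu_j` is bounded by a multiple of `lam_j ^ (-s)`.
Identifying `ℋ^s` isometrically with a subspace of `ℓ²` turns this sum into a Bochner norm bound. -/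

/-! ### Pathwise estimates for the scalar equation -/

/-- Variation of constants for the scalar linear equation, with the noise entering only through
its increments. -/
theorem eq_exp_mul_add_integral_increment {a c t : ℝ} {u N : ℝ → ℝ} (ht : 0 ≤ t)
    (hu : ContinuousOn u (Icc 0 t)) (hN : ContinuousOn N (Icc 0 t))
    (h : ∀ r ∈ Icc 0 t, u r = c - a * (∫ τ in (0 : ℝ)..r, u τ) + N r) :
    u t = Real.exp (-a * t) * (c + N t)
      + ∫ r in (0 : ℝ)..t, a * Real.exp (-a * (t - r)) * (N t - N r) := by
  have hint : ∀ r ∈ Icc 0 t, IntervalIntegrable u volume 0 r := fun r hr =>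
    (hu.mono (by rw [uIcc_of_le hr.1]; exact Icc_subset_Icc_right hr.2)).intervalIntegrable
  have hFc : ContinuousOn (fun r => ∫ τ in (0 : ℝ)..r, u τ) (Icc 0 t) := by
    have := intervalIntegral.continuousOn_primitive_interval (μ := volume) (f := u)
      (a := 0) (b := t) (by rw [uIcc_of_le ht]; exact hu.integrableOn_Icc)
    rwa [uIcc_of_le ht] at this
  -- By the equation at `t`, the primitive below equals `u t` at `r = t`; at `r = 0` it is the
  -- boundary term. Substituting the equation for `u r` in its derivative leaves only `N t - N r`.
  have key := intervalIntegral.integral_eq_sub_of_hasDerivAt_of_le (a := 0) (b := t)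
    (f := fun r => Real.exp (-a * (t - r)) * (c + N t - a * ∫ τ in (0 : ℝ)..r, u τ))
    (f' := fun r => a * Real.exp (-a * (t - r)) * (N t - N r)) ht
    (by fun_prop) ?_ ?_
  · rw [key, h t ⟨ht, le_rfl⟩]
    simp only [intervalIntegral.integral_same, sub_self, mul_zero, Real.exp_zero, sub_zero]
    ring
  · intro x hx
    have hx' : x ∈ Icc 0 t := Ioo_subset_Icc_self hx
    have hF : HasDerivAt (fun r => ∫ τ in (0 : ℝ)..r, u τ) (u x) x :=
      intervalIntegral.integral_hasDerivAt_right (hint x hx')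
        ((hu.mono Ioo_subset_Icc_self).stronglyMeasurableAtFilter isOpen_Ioo x hx)
        (hu.continuousAt (Icc_mem_nhds hx.1 hx.2))
    have hE : HasDerivAt (fun r => Real.exp (-a * (t - r))) (Real.exp (-a * (t - x)) * a) x := by
      have : HasDerivAt (fun r => -a * (t - r)) a x := by
        simpa using ((hasDerivAt_id x).const_sub t).const_mul (-a)
      exact this.exp
    refine (hE.mul ((hF.const_mul a).const_sub (c + N t))).congr_deriv ?_
    rw [h x hx']
    ring
  · apply ContinuousOn.intervalIntegrable
    rw [uIcc_of_le ht]
    fun_prop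

theorem integral_exp_kernel (a t : ℝ) :
    ∫ r in (0 : ℝ)..t, a * Real.exp (-a * (t - r)) = 1 - Real.exp (-a * t) := by
  rw [intervalIntegral.integral_eq_sub_of_hasDerivAt (f := fun r => Real.exp (-a * (t - r)))]
  · simp
  · intro x _
    have : HasDerivAt (fun r => -a * (t - r)) a x := by
      simpa using ((hasDerivAt_id x).const_sub t).const_mul (-a)
    exact this.exp.congr_deriv (by ring)
  · exact Continuous.intervalIntegrable (by fun_prop) _ _

/-- The kernel concentrates on `t - r` of order `1 / a`; this is the gain that compensates one of
the two powers of `a` in the `ℋ^s` weight. -/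
theorem integral_exp_kernel_mul_le {a t : ℝ} (ha : 0 < a) (ht : 0 ≤ t) :
    ∫ r in (0 : ℝ)..t, a * Real.exp (-a * (t - r)) * (t - r) ≤ 1 / a := by
  rw [intervalIntegral.integral_eq_sub_of_hasDerivAt
    (f := fun r => Real.exp (-a * (t - r)) * (t - r + 1 / a))]
  · have : 0 ≤ Real.exp (-a * (t - 0)) * (t - 0 + 1 / a) := by
      have := sub_nonneg.2 ht
      positivity
    simpa using this
  · intro x _
    have h1 : HasDerivAt (fun r => -a * (t - r)) a x := by
      simpa using ((hasDerivAt_id x).const_sub t).const_mul (-a)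
    have h2 : HasDerivAt (fun r => t - r + 1 / a) (-1) x := by
      simpa using ((hasDerivAt_id x).const_sub t).add_const (1 / a)
    refine (h1.exp.mul h2).congr_deriv ?_
    field_simp
    ring
  · exact Continuous.intervalIntegrable (by fun_prop) _ _

/-- Cauchy–Schwarz for a nonnegative kernel of mass at most one. -/
theorem sq_intervalIntegral_mul_le {t : ℝ} {k f : ℝ → ℝ} (ht : 0 ≤ t)
    (hk : ContinuousOn k (Icc 0 t)) (hf : ContinuousOn f (Icc 0 t))
    (hk0 : ∀ r ∈ Icc 0 t, 0 ≤ k r) (hk1 : ∫ r in (0 : ℝ)..t, k r ≤ 1) :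
    (∫ r in (0 : ℝ)..t, k r * f r) ^ 2 ≤ ∫ r in (0 : ℝ)..t, k r * f r ^ 2 := by
  set m := ∫ r in (0 : ℝ)..t, k r * f r with hm
  have hI : ∀ g : ℝ → ℝ, ContinuousOn g (Icc 0 t) → IntervalIntegrable g volume 0 t :=
    fun g hg => ContinuousOn.intervalIntegrable (by rwa [uIcc_of_le ht])
  -- A variance argument: expanding the square around `m` gives `∫ k f² - 2 m² + m² ∫ k`, and mass
  -- at most one makes this at most `∫ k f² - m²`.
  have h0 : 0 ≤ ∫ r in (0 : ℝ)..t, k r * (f r - m) ^ 2 :=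
    intervalIntegral.integral_nonneg ht fun r hr => mul_nonneg (hk0 r hr) (sq_nonneg _)
  have h1 : ∫ r in (0 : ℝ)..t, k r * (f r - m) ^ 2 =
      (∫ r in (0 : ℝ)..t, k r * f r ^ 2) - 2 * m * m + m ^ 2 * ∫ r in (0 : ℝ)..t, k r := by
    have e : ∀ r, k r * (f r - m) ^ 2 = k r * f r ^ 2 - 2 * m * (k r * f r) + m ^ 2 * k r :=
      fun r => by ring
    simp only [e]
    rw [intervalIntegral.integral_add (hI _ (by fun_prop)) (hI _ (by fun_prop)),
      intervalIntegral.integral_sub (hI _ (by fun_prop)) (hI _ (by fun_prop)),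
      intervalIntegral.integral_const_mul, intervalIntegral.integral_const_mul]
  nlinarith [mul_le_mul_of_nonneg_left hk1 (sq_nonneg m)]

theorem sq_le_of_linear_integral_equation {a c t : ℝ} {u N : ℝ → ℝ} (ha : 0 < a) (ht : 0 ≤ t)
    (hu : ContinuousOn u (Icc 0 t)) (hN : ContinuousOn N (Icc 0 t))
    (h : ∀ r ∈ Icc 0 t, u r = c - a * (∫ τ in (0 : ℝ)..r, u τ) + N r) :
    u t ^ 2 ≤ 3 * (Real.exp (-2 * a * t) * c ^ 2 + Real.exp (-2 * a * t) * N t ^ 2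
      + ∫ r in (0 : ℝ)..t, a * Real.exp (-a * (t - r)) * (N t - N r) ^ 2) := by
  have h1 := sq_intervalIntegral_mul_le (k := fun r => a * Real.exp (-a * (t - r)))
    (f := fun r => N t - N r) ht (by fun_prop) (by fun_prop) (fun r _ => by positivity)
    (by rw [integral_exp_kernel]; linarith [Real.exp_pos (-a * t)])
  rw [eq_exp_mul_add_integral_increment ht hu hN h]
  set I := ∫ r in (0 : ℝ)..t, a * Real.exp (-a * (t - r)) * (N t - N r)
  have he : Real.exp (-2 * a * t) = Real.exp (-a * t) ^ 2 := by
    rw [← Real.exp_nat_mul]; congr 1; push_cast; ring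
  rw [he]
  set x := Real.exp (-a * t)
  -- This is `(p + q + r)² ≤ 3 (p² + q² + r²)`, the source of the factor 3.
  nlinarith [sq_nonneg (x * c - x * N t), sq_nonneg (x * c - I), sq_nonneg (x * N t - I)]

/-! ### Joint measurability and second moments -/

/-- A process with continuous paths that is measurable at each time is jointly measurable.
Exceptional paths are replaced by zero and time is clamped to `[0, T]`, which changes the process
only on a null set. -/
theorem aemeasurable_prod_of_ae_continuousOn {Ω : Type*} {mΩ : MeasurableSpace Ω}
    {P : Measure Ω} [SFinite P] {T : ℝ} (hT : 0 ≤ T) {X : ℝ → Ω → ℝ}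
    (hm : ∀ t ∈ Icc 0 T, Measurable (X t))
    (hc : ∀ᵐ ω ∂P, ContinuousOn (fun t => X t ω) (Icc 0 T)) :
    AEMeasurable (fun z : Ω × ℝ => X z.2 z.1) (P.prod (volume.restrict (Icc 0 T))) := by
  classical
  obtain ⟨G, hGae, hGm, hG⟩ := hc.exists_measurable_mem
  let V : ℝ → Ω → ℝ := fun t => G.indicator (X (projIcc 0 T hT t))
  have hV : Measurable (Function.uncurry V) := by
    refine measurable_uncurry_of_continuous_of_measurable (fun ω => ?_) fun t =>
      (hm _ (projIcc 0 T hT t).2).indicator hGm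
    by_cases hω : ω ∈ G
    · have : Continuous fun t => X (projIcc 0 T hT t) ω :=
        (continuousOn_iff_continuous_domRestrict.1 (hG ω hω)).comp continuous_projIcc
      simpa [V, hω] using this
    · simpa [V, hω] using continuous_const
  refine ⟨fun z => V z.2 z.1, hV.comp measurable_swap, ?_⟩
  have h1 : ∀ᵐ z ∂P.prod (volume.restrict (Icc 0 T)), z.1 ∈ G :=
    Measure.quasiMeasurePreserving_fst.ae hGae
  have h2 : ∀ᵐ z ∂P.prod (volume.restrict (Icc 0 T)), z.2 ∈ Icc 0 T :=
    Measure.quasiMeasurePreserving_snd.ae (ae_restrict_mem measurableSet_Icc)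
  filter_upwards [h1, h2] with z hz1 hz2
  simp [V, hz1, projIcc_of_mem hT hz2]

theorem lintegral_sq_of_hasLaw_gaussianReal {Ω : Type*} {mΩ : MeasurableSpace Ω}
    {P : Measure Ω} {X : Ω → ℝ} {v : ℝ≥0} (hX : HasLaw X (gaussianReal 0 v) P) :
    ∫⁻ ω, ENNReal.ofReal (X ω ^ 2) ∂P = v := by
  rw [hX.lintegral_comp (f := fun x => ENNReal.ofReal (x ^ 2)) (by fun_prop),
    ← ofReal_integral_eq_lintegral_ofReal]
  · have := variance_of_integral_eq_zero (μ := gaussianReal 0 v) (X := id) aemeasurable_id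
      (by simp)
    rw [variance_id_gaussianReal] at this
    simp only [id] at this
    rw [← this]
    simp
  · exact (memLp_id_gaussianReal (μ := 0) (v := v) 2).integrable_sq
  · exact ae_of_all _ fun x => sq_nonneg x

/-- Second moment bound for an Ornstein–Uhlenbeck type process. -/
theorem lintegral_sq_le_of_linear_integral_equation {Ω : Type*} {mΩ : MeasurableSpace Ω}
    {P : Measure Ω} [IsProbabilityMeasure P] {a c m t : ℝ} (ha : 0 < a) (hm : 0 ≤ m) (ht : 0 ≤ t)
    {u N : ℝ → Ω → ℝ} (hNm : ∀ r ∈ Icc 0 t, Measurable (N r))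
    (hN0 : ∀ᵐ ω ∂P, N 0 ω = 0)
    (hNc : ∀ᵐ ω ∂P, ContinuousOn (fun r => N r ω) (Icc 0 t))
    (hN2 : ∀ r ∈ Icc 0 t,
      ∫⁻ ω, ENNReal.ofReal ((N t ω - N r ω) ^ 2) ∂P ≤ ENNReal.ofReal (m * (t - r)))
    (hu : ∀ᵐ ω ∂P, ContinuousOn (fun r => u r ω) (Icc 0 t) ∧
      ∀ r ∈ Icc 0 t, u r ω = c - a * (∫ τ in (0 : ℝ)..r, u τ ω) + N r ω) :
    ∫⁻ ω, ENNReal.ofReal (u t ω ^ 2) ∂P ≤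
      ENNReal.ofReal (3 * (Real.exp (-2 * a * t) * c ^ 2 + 2 * m / a)) := by
  have ht0 : (0 : ℝ) ∈ Icc 0 t := ⟨le_rfl, ht⟩
  have htt : t ∈ Icc 0 t := ⟨ht, le_rfl⟩
  let k : ℝ → ℝ := fun r => a * Real.exp (-a * (t - r))
  have hk : ∀ r, 0 ≤ k r := fun r => by positivity
  have hkc : Continuous k := by fun_prop
  -- Since `N 0 = 0` almost surely, `N t` is itself the increment from time `0`, so `hN2` controls
  -- both noise terms.
  have hpt : ∀ᵐ ω ∂P, ENNReal.ofReal (u t ω ^ 2) ≤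
      ENNReal.ofReal 3 * (ENNReal.ofReal (Real.exp (-2 * a * t) * c ^ 2)
        + ENNReal.ofReal (Real.exp (-2 * a * t)) * ENNReal.ofReal ((N t ω - N 0 ω) ^ 2)
        + ∫⁻ r in Icc 0 t, ENNReal.ofReal (k r) * ENNReal.ofReal ((N t ω - N r ω) ^ 2)) := by
    filter_upwards [hN0, hNc, hu] with ω h0 hc h
    have hle := sq_le_of_linear_integral_equation ha ht h.1 hc h.2
    have hcont : ContinuousOn (fun r => k r * (N t ω - N r ω) ^ 2) (Icc 0 t) := by fun_prop
    have hnn : ∀ r, 0 ≤ k r * (N t ω - N r ω) ^ 2 := fun r => mul_nonneg (hk r) (sq_nonneg _)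
    have hI : ENNReal.ofReal (∫ r in (0 : ℝ)..t, k r * (N t ω - N r ω) ^ 2) =
        ∫⁻ r in Icc 0 t, ENNReal.ofReal (k r) * ENNReal.ofReal ((N t ω - N r ω) ^ 2) := by
      rw [intervalIntegral.integral_of_le ht, ← integral_Icc_eq_integral_Ioc,
        ofReal_integral_eq_lintegral_ofReal hcont.integrableOn_Icc (ae_of_all _ hnn)]
      simp only [ENNReal.ofReal_mul (hk _)]
    have hI0 : 0 ≤ ∫ r in (0 : ℝ)..t, k r * (N t ω - N r ω) ^ 2 :=
      intervalIntegral.integral_nonneg ht fun r _ => hnn r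
    rw [← hI, h0, sub_zero, ← ENNReal.ofReal_mul (by positivity),
      ← ENNReal.ofReal_add (by positivity) (by positivity),
      ← ENNReal.ofReal_add (by positivity) hI0, ← ENNReal.ofReal_mul (by norm_num)]
    exact ENNReal.ofReal_le_ofReal hle
  have hjoint : AEMeasurable (fun z : Ω × ℝ =>
      ENNReal.ofReal (k z.2) * ENNReal.ofReal ((N t z.1 - N z.2 z.1) ^ 2))
      (P.prod (volume.restrict (Icc 0 t))) := by
    have h1 := aemeasurable_prod_of_ae_continuousOn ht hNm hNc
    have h2 : Measurable fun z : Ω × ℝ => N t z.1 := (hNm t htt).comp measurable_fst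
    have h3 : Measurable fun z : Ω × ℝ => k z.2 := hkc.measurable.comp measurable_snd
    exact h3.ennreal_ofReal.aemeasurable.mul ((h2.aemeasurable.sub h1).pow_const 2).ennreal_ofReal
  have hinc : ∀ r ∈ Icc 0 t, Measurable fun ω => ENNReal.ofReal ((N t ω - N r ω) ^ 2) :=
    fun r hr => (((hNm t htt).sub (hNm r hr)).pow_const 2).ennreal_ofReal
  have hdouble : ∫⁻ ω, (∫⁻ r in Icc 0 t,
      ENNReal.ofReal (k r) * ENNReal.ofReal ((N t ω - N r ω) ^ 2)) ∂P ≤ ENNReal.ofReal (m / a) := by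
    rw [lintegral_lintegral_swap hjoint]
    calc _ ≤ ∫⁻ r in Icc 0 t, ENNReal.ofReal (k r * (m * (t - r))) := by
            refine setLIntegral_mono' measurableSet_Icc fun r hr => ?_
            rw [lintegral_const_mul _ (hinc r hr), ENNReal.ofReal_mul (hk r)]
            gcongr
            exact hN2 r hr
      _ = ENNReal.ofReal (∫ r in Icc 0 t, k r * (m * (t - r))) := by
            rw [ofReal_integral_eq_lintegral_ofReal]
            · exact (Continuous.continuousOn (by fun_prop)).integrableOn_Icc
            · filter_upwards [ae_restrict_mem measurableSet_Icc] with r hr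
              exact mul_nonneg (hk r) (mul_nonneg hm (sub_nonneg.2 hr.2))
      _ ≤ _ := by
            refine ENNReal.ofReal_le_ofReal ?_
            rw [integral_Icc_eq_integral_Ioc, ← intervalIntegral.integral_of_le ht]
            have e : ∀ r, k r * (m * (t - r)) = m * (a * Real.exp (-a * (t - r)) * (t - r)) :=
              fun r => by simp only [k]; ring
            simp only [e, intervalIntegral.integral_const_mul]
            calc _ ≤ m * (1 / a) :=
                  mul_le_mul_of_nonneg_left (integral_exp_kernel_mul_le ha ht) hm
              _ = m / a := by ring
  have hsingle : ENNReal.ofReal (Real.exp (-2 * a * t)) *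
      ∫⁻ ω, ENNReal.ofReal ((N t ω - N 0 ω) ^ 2) ∂P ≤ ENNReal.ofReal (m / a) := by
    calc _ ≤ ENNReal.ofReal (Real.exp (-2 * a * t)) * ENNReal.ofReal (m * (t - 0)) := by
            gcongr
            exact hN2 0 ht0
      _ ≤ _ := by
            rw [← ENNReal.ofReal_mul (by positivity)]
            refine ENNReal.ofReal_le_ofReal ?_
            -- The factor `exp (-2 a t)` absorbs the growth of `E N(t)² ≤ m t`, so the boundary term
            -- is also at most `m / a`, uniformly in `t`.
            have h1 : 2 * a * t + 1 ≤ Real.exp (2 * a * t) := Real.add_one_le_exp _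
            have h2 : Real.exp (-2 * a * t) * Real.exp (2 * a * t) = 1 := by
              rw [← Real.exp_add]; simp
            have h3 : Real.exp (-2 * a * t) * (a * t) ≤ 1 := by
              rw [← h2]
              gcongr
              nlinarith [mul_nonneg ha.le ht]
            rw [le_div_iff₀ ha]
            calc _ = m * (Real.exp (-2 * a * t) * (a * t)) := by ring
              _ ≤ m := mul_le_of_le_one_right hm h3
  refine (lintegral_mono_ae hpt).trans ?_
  have hma : 0 ≤ m / a := by positivity
  have hm1 : Measurable fun ω => ENNReal.ofReal (Real.exp (-2 * a * t) * c ^ 2)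
        + ENNReal.ofReal (Real.exp (-2 * a * t)) * ENNReal.ofReal ((N t ω - N 0 ω) ^ 2) :=
    measurable_const.add ((hinc 0 ht0).const_mul _)
  rw [lintegral_const_mul' _ _ (by simp), lintegral_add_left hm1,
    lintegral_add_left measurable_const, lintegral_const_mul _ (hinc 0 ht0), lintegral_const,
    measure_univ, mul_one, ENNReal.ofReal_mul (by norm_num : (0 : ℝ) ≤ 3)]
  gcongr
  calc _ ≤ ENNReal.ofReal (Real.exp (-2 * a * t) * c ^ 2) + ENNReal.ofReal (m / a)
        + ENNReal.ofReal (m / a) := by gcongr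
    _ = _ := by
      rw [← ENNReal.ofReal_add (by positivity) hma, ← ENNReal.ofReal_add (by positivity) hma]
      congr 1
      ring

/-- Parabolic smoothing of the initial datum: integration in time gains `1 / (2 a)`, so the weight
`a²` on `c²` drops to `a`, that is, from `ℋ^s` to `ℋ^{s/2}`. -/
theorem setLIntegral_exp_decay_le {a b d T : ℝ} (ha : 0 < a) (hb : 0 ≤ b) (hd : 0 ≤ d)
    (hT : 0 ≤ T) :
    ∫⁻ t in Icc 0 T, ENNReal.ofReal (3 * (Real.exp (-2 * a * t) * b + d)) ≤
      ENNReal.ofReal (3 * (b / (2 * a) + T * d)) := by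
  rw [← ofReal_integral_eq_lintegral_ofReal
    (Continuous.continuousOn (by fun_prop)).integrableOn_Icc
    (ae_of_all _ fun t => by positivity)]
  refine ENNReal.ofReal_le_ofReal ?_
  rw [integral_Icc_eq_integral_Ioc, ← intervalIntegral.integral_of_le hT,
    intervalIntegral.integral_eq_sub_of_hasDerivAt
      (f := fun t => 3 * (-(Real.exp (-2 * a * t) * (b / (2 * a))) + t * d))]
  · have : 0 ≤ Real.exp (-2 * a * T) * (b / (2 * a)) := by positivity
    simp only [mul_zero, Real.exp_zero, zero_mul]
    linarith
  · intro x _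
    have h1 : HasDerivAt (fun r => -2 * a * r) (-2 * a) x := by
      simpa using (hasDerivAt_id x).const_mul (-2 * a)
    refine (((h1.exp.mul_const (b / (2 * a))).neg.add
      ((hasDerivAt_id x).mul_const d)).const_mul 3).congr_deriv ?_
    field_simp
  · exact Continuous.intervalIntegrable (by fun_prop) _ _

/-! ### From coordinates to the Bochner space -/

namespace FracSPDE

section Bochner

variable {H : Type*} [NormedAddCommGroup H] [InnerProductSpace ℝ H] {A : H →ₗ.[ℝ] H}

theorem Hs.isometry_toLp (S : EigenSystem A) (s : ℝ) : Isometry (Hs.toLp S s) :=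
  fun _ _ => rfl

theorem Hs.enorm_sq_eq (S : EigenSystem A) (s : ℝ) (v : Hs S s) :
    ‖v‖ₑ ^ (2 : ℝ) = ∑' j, ENNReal.ofReal (wcoord S s (Hs.incl S s v) j ^ 2) := by
  have hsum : Summable fun j => wcoord S s (Hs.incl S s v) j ^ 2 := by
    have h : Memℓp (wcoord S s (Hs.incl S s v)) 2 := v.2
    rw [memℓp_gen_iff (by norm_num)] at h
    simpa using h
  have hn : ‖v‖ ^ 2 = ∑' j, wcoord S s (Hs.incl S s v) j ^ 2 := by
    have h := lp.norm_rpow_eq_tsum (p := 2) (by norm_num) (Hs.toLp S s v)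
    change ‖v‖ ^ _ = ∑' j, ‖wcoord S s (Hs.incl S s v) j‖ ^ _ at h
    simpa using h
  rw [← ENNReal.ofReal_tsum_of_nonneg (fun j => sq_nonneg _) hsum, ← hn, ← ofReal_norm,
    ENNReal.ofReal_rpow_of_nonneg (norm_nonneg v) (by norm_num)]
  norm_num

/-- Under the isometric embedding into `ℓ²`, `Y` is the pointwise limit of its finite coordinate
sums, and strong measurability is reflected by embeddings. -/
theorem Hs.aestronglyMeasurable_of_coord (S : EigenSystem A) (s : ℝ) {X : Type*}
    {mX : MeasurableSpace X} {m : Measure X} {Y : X → Hs S s}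
    (h : ∀ j, AEMeasurable (fun x => wcoord S s (Hs.incl S s (Y x)) j) m) :
    AEStronglyMeasurable Y m := by
  classical
  rw [← (Hs.isometry_toLp S s).isEmbedding.aestronglyMeasurable_comp_iff]
  refine aestronglyMeasurable_of_tendsto_ae atTop
    (f := fun n x => ∑ j ∈ Finset.range n,
      lp.singleContinuousLinearMap ℝ (fun _ : ℕ => ℝ) 2 j (wcoord S s (Hs.incl S s (Y x)) j))
    (fun n => ?_) (ae_of_all _ fun x => ?_)
  · refine Finset.aestronglyMeasurable_fun_sum _ fun j _ => ?_
    exact (ContinuousLinearMap.continuous _).comp_aestronglyMeasurable (h j).aestronglyMeasurable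
  · exact (lp.hasSum_single (by norm_num) (Hs.toLp S s (Y x))).tendsto_sum_nat

/-- A function with measurable coordinates and square-integrable `ℋ^s` norm lies in `L²(m; ℋ^s)`. -/
theorem exists_isL2HsRep_of_tsum_lintegral_le (S : EigenSystem A) (s : ℝ) {X : Type*}
    {mX : MeasurableSpace X} {m : Measure X} {f : X → H} {K : ℝ} (hK : 0 ≤ K)
    (hf : ∀ j, AEMeasurable (fun x => inner ℝ (f x) (S.e j)) m)
    (hle : ∑' j, ∫⁻ x, ENNReal.ofReal (wcoord S s (f x) j ^ 2) ∂m ≤ ENNReal.ofReal K) :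
    ∃ Y : X → Hs S s, IsL2HsRep S s m f Y ∧ eLpNorm Y 2 m ≤ ENNReal.ofReal (√K) := by
  classical
  have hw : ∀ j, AEMeasurable (fun x => wcoord S s (f x) j) m := fun j => (hf j).const_mul _
  have hw2 : ∀ j, AEMeasurable (fun x => ENNReal.ofReal (wcoord S s (f x) j ^ 2)) m :=
    fun j => ((hw j).pow_const 2).ennreal_ofReal
  rw [← lintegral_tsum hw2] at hle
  -- A sum with finite integral is finite almost everywhere, and finiteness of this sum is exactly
  -- membership in `ℋ^s`.
  have hmem : ∀ᵐ x ∂m, f x ∈ hsSubmodule S s := by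
    filter_upwards [ae_lt_top' (AEMeasurable.tsum hw2)
      (hle.trans_lt ENNReal.ofReal_lt_top).ne] with x hx
    have h := ENNReal.summable_toReal hx.ne
    change Memℓp (wcoord S s (f x)) 2
    rw [memℓp_gen_iff (by norm_num)]
    refine h.congr fun j => ?_
    rw [ENNReal.toReal_ofReal (sq_nonneg _)]
    simp
  let Y : X → Hs S s := fun x => if h : f x ∈ hsSubmodule S s then ⟨f x, h⟩ else 0
  have hY : ∀ᵐ x ∂m, Hs.incl S s (Y x) = f x := by
    filter_upwards [hmem] with x hx
    have h : Y x = ⟨f x, hx⟩ := dif_pos hx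
    rw [h]
    rfl
  have hYm : AEStronglyMeasurable Y m := by
    refine Hs.aestronglyMeasurable_of_coord S s fun j => (hw j).congr ?_
    filter_upwards [hY] with x hx
    rw [hx]
  have hnorm : eLpNorm Y 2 m ≤ ENNReal.ofReal (√K) := by
    rw [eLpNorm_eq_lintegral_rpow_enorm_toReal (by norm_num) (by norm_num), Real.sqrt_eq_rpow,
      ← ENNReal.ofReal_rpow_of_nonneg hK (by norm_num)]
    simp only [ENNReal.toReal_ofNat]
    refine ENNReal.rpow_le_rpow (le_trans (le_of_eq ?_) hle) (by norm_num)
    refine lintegral_congr_ae ?_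
    filter_upwards [hY] with x hx
    rw [Hs.enorm_sq_eq, hx]
  exact ⟨Y, ⟨hY, hYm, hnorm.trans_lt ENNReal.ofReal_lt_top⟩, hnorm⟩

/-- The product is of order `lam_j ^ (-ε) lam_j ^ (-s)`, and the first factor is at most `lam_0 ^
(-ε)` because the eigenvalues are nondecreasing. -/
theorem DecayAssumption.summable_rpow_mul (S : EigenSystem A) {mu : ℕ → ℝ} {s : ℝ}
    (h : DecayAssumption S.lam mu s) : Summable fun j => S.lam j ^ s * mu j := by
  obtain ⟨⟨ε, hε, hmu⟩, hsum⟩ := h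
  refine summable_of_isBigO_nat hsum ?_
  have h1 : (fun j => S.lam j ^ s * mu j) =O[atTop]
      fun j => S.lam j ^ s * S.lam j ^ (-2 * s - ε) := (Asymptotics.isBigO_refl _ _).mul hmu.1
  refine h1.trans (Asymptotics.IsBigO.of_bound (S.lam 0 ^ (-ε)) (Eventually.of_forall fun j => ?_))
  have hj := S.pos j
  have e : S.lam j ^ s * S.lam j ^ (-2 * s - ε) = S.lam j ^ (-ε) * S.lam j ^ (-s) := by
    rw [← Real.rpow_add hj, ← Real.rpow_add hj]
    congr 1
    ring
  rw [e, norm_mul, Real.norm_of_nonneg (Real.rpow_nonneg hj.le _)]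
  gcongr ?_ * _
  exact Real.rpow_le_rpow_of_nonpos (S.pos 0) (S.mono (Nat.zero_le j)) (by linarith)

theorem IsDiagonalCovariance.inner_apply [CompleteSpace H] {e : HilbertBasis ℕ ℝ H}
    {Q : H →L[ℝ] H} {mu : ℕ → ℝ} (hQ : IsDiagonalCovariance e Q mu) (j : ℕ) :
    inner ℝ (Q (e j)) (e j) = mu j := by
  rw [hQ.apply_eq, inner_smul_left, real_inner_self_eq_norm_sq, e.orthonormal.1 j]
  simp

theorem IsDiagonalCovariance.nonneg [CompleteSpace H] {e : HilbertBasis ℕ ℝ H}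
    {Q : H →L[ℝ] H} {mu : ℕ → ℝ} (hQ : IsDiagonalCovariance e Q mu) (j : ℕ) : 0 ≤ mu j := by
  rw [← hQ.inner_apply j]
  exact hQ.isPositive.inner_nonneg_left _

end Bochner

/-! ### Moments of the coordinates of a solution -/

section Noise

variable {H : Type*} [NormedAddCommGroup H] [InnerProductSpace ℝ H]
  [MeasurableSpace H] [BorelSpace H] {A : H →ₗ.[ℝ] H} {Ω : Type*} {mΩ : MeasurableSpace Ω}
  {P : Measure Ω} {ℱ : Filtration ℝ mΩ} {Q : H →L[ℝ] H} {T : ℝ} {W : ℝ → Ω → H}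

theorem IsQWiener.measurable_inner (hW : IsQWiener P ℱ Q T W) (h : H) {t : ℝ} (ht : t ∈ Icc 0 T) :
    Measurable fun ω => inner ℝ (W t ω) h :=
  (((hW.adapted t ht).mono (ℱ.le t)).inner stronglyMeasurable_const).measurable

theorem IsQWiener.lintegral_sq_increment (hW : IsQWiener P ℱ Q T W) (h : H) {r t : ℝ}
    (hr : r ∈ Icc 0 T) (ht : t ∈ Icc 0 T) (hrt : r ≤ t) :
    ∫⁻ ω, ENNReal.ofReal ((inner ℝ (W t ω) h - inner ℝ (W r ω) h) ^ 2) ∂P =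
      ENNReal.ofReal ((t - r) * inner ℝ (Q h) h) := by
  simp only [← inner_sub_left]
  exact lintegral_sq_of_hasLaw_gaussianReal (hW.law r hr t ht hrt h)

/-- Weighted second moment of a coordinate of the solution, integrated in time. -/
theorem IsSolution.lintegral_wcoord_sq_le [CompleteSpace H] [IsProbabilityMeasure P]
    {S : EigenSystem A} {mu : ℕ → ℝ} {s : ℝ} {y0 : H} {y : ℝ → Ω → H} (hQ : IsDiagonalCovariance S.e Q mu)
    (hT : 0 ≤ T) (hW : IsQWiener P ℱ Q T W) (hy : IsSolution S mu s T y0 P ℱ W y) (j : ℕ)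
    (hmeas : AEMeasurable (fun z : Ω × ℝ => inner ℝ (y z.2 z.1) (S.e j))
      (P.prod (volume.restrict (Icc 0 T)))) :
    ∫⁻ z, ENNReal.ofReal (wcoord S s (y z.2 z.1) j ^ 2) ∂(P.prod (volume.restrict (Icc 0 T))) ≤
      ENNReal.ofReal (3 / 2 * (S.lam j ^ s * inner ℝ y0 (S.e j) ^ 2)
        + 6 * T * (S.lam j ^ s * mu j)) := by
  set a := S.lam j ^ s with ha'
  have ha : 0 < a := Real.rpow_pos_of_pos (S.pos j) s
  have hmu : 0 ≤ mu j := hQ.nonneg j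
  set c := inner ℝ y0 (S.e j) with hc
  let N : ℝ → Ω → ℝ := fun t ω => √(mu j) * brownianCoord S.e mu W j t ω
  have hN : ∀ t ω, N t ω = √(mu j) * (√(mu j))⁻¹ * inner ℝ (W t ω) (S.e j) := fun t ω => by
    simp only [N, brownianCoord, mul_assoc]
  -- If `mu j = 0` the inverse is `0` by convention and both sides vanish; otherwise the factor is
  -- `1`.
  have hq : (√(mu j) * (√(mu j))⁻¹) ^ 2 * mu j = mu j := by
    rcases hmu.eq_or_lt with h | h
    · simp [← h]
    · rw [mul_inv_cancel₀ (Real.sqrt_pos.2 h).ne']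
      ring
  have hNm : ∀ r ∈ Icc 0 T, Measurable (N r) := fun r hr => by
    simp only [funext (hN r)]
    exact (hW.measurable_inner (S.e j) hr).const_mul _
  have hN0 : ∀ᵐ ω ∂P, N 0 ω = 0 := by
    filter_upwards [hW.zero] with ω h
    simp [hN, h]
  have hNc : ∀ᵐ ω ∂P, ContinuousOn (fun r => N r ω) (Icc 0 T) := by
    filter_upwards [hW.cont] with ω h
    simp only [hN]
    exact continuousOn_const.mul (h.inner continuousOn_const)
  have hN2 : ∀ t ∈ Icc 0 T, ∀ r ∈ Icc 0 t,
      ∫⁻ ω, ENNReal.ofReal ((N t ω - N r ω) ^ 2) ∂P ≤ ENNReal.ofReal (mu j * (t - r)) := by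
    intro t ht r hr
    have hr' : r ∈ Icc 0 T := ⟨hr.1, hr.2.trans ht.2⟩
    simp only [hN, ← mul_sub, mul_pow _ (_ - _), ENNReal.ofReal_mul (sq_nonneg _)]
    rw [lintegral_const_mul' _ _ ENNReal.ofReal_ne_top,
      hW.lintegral_sq_increment (S.e j) hr' ht hr.2, hQ.inner_apply,
      ← ENNReal.ofReal_mul (sq_nonneg _)]
    refine ENNReal.ofReal_le_ofReal (le_of_eq ?_)
    linear_combination (t - r) * hq
  have hmoment : ∀ t ∈ Icc 0 T, ∫⁻ ω, ENNReal.ofReal (inner ℝ (y t ω) (S.e j) ^ 2) ∂P ≤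
      ENNReal.ofReal (3 * (Real.exp (-2 * a * t) * c ^ 2 + 2 * mu j / a)) := by
    intro t ht
    have hsub : Icc 0 t ⊆ Icc 0 T := Icc_subset_Icc_right ht.2
    refine lintegral_sq_le_of_linear_integral_equation (u := fun t ω => inner ℝ (y t ω) (S.e j))
      ha hmu ht.1 (fun r hr => hNm r (hsub hr)) hN0 (hNc.mono fun ω h => h.mono hsub) (hN2 t ht) ?_
    filter_upwards [hy.ito j] with ω h
    exact ⟨h.1.mono hsub, fun r hr => h.2 r (hsub hr)⟩
  simp only [wcoord, ← ha', mul_pow, ENNReal.ofReal_mul (sq_nonneg a)]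
  rw [lintegral_const_mul' _ _ ENNReal.ofReal_ne_top,
    lintegral_prod_symm _ (hmeas.pow_const 2).ennreal_ofReal]
  calc _ ≤ ENNReal.ofReal (a ^ 2) * ∫⁻ t in Icc 0 T,
          ENNReal.ofReal (3 * (Real.exp (-2 * a * t) * c ^ 2 + 2 * mu j / a)) := by
        exact mul_le_mul_right (setLIntegral_mono' measurableSet_Icc hmoment) _
    _ ≤ ENNReal.ofReal (a ^ 2) *
          ENNReal.ofReal (3 * (c ^ 2 / (2 * a) + T * (2 * mu j / a))) := by
        gcongr
        exact setLIntegral_exp_decay_le ha (sq_nonneg c) (by positivity) hT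
    _ = _ := by
        rw [← ENNReal.ofReal_mul (sq_nonneg a)]
        congr 1
        field_simp
        ring

end Noise

end FracSPDE

/-! ### Summation over the modes -/

theorem mainTheorem7 {E : Type*} [NormedAddCommGroup E] [InnerProductSpace ℝ E]
    [FiniteDimensional ℝ E] [MeasurableSpace E] [BorelSpace E]
    (D : Set E) (hD_open : IsOpen D) (hD_conn : IsConnected D) (hD_bdd : Bornology.IsBounded D)
    (A : L2 D →ₗ.[ℝ] L2 D) (hA : FracSPDE.IsPositiveWithCompactInverse A)
    (S : FracSPDE.EigenSystem A)
    (Q : L2 D →L[ℝ] L2 D) (mu : ℕ → ℝ) (hQ : FracSPDE.IsDiagonalCovariance S.e Q mu)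
    (s : ℝ) (hs : 0 < s) (hdecay : FracSPDE.DecayAssumption S.lam mu s)
    (T : ℝ) (hT : 0 < T)
    (y0 : L2 D) (hy0 : y0 ∈ FracSPDE.hsSubmodule S (s / 2)) :
    ∃ C : ℝ, 0 < C ∧
      ∀ (Ω : Type*) (mΩ : MeasurableSpace Ω) (P : Measure Ω) (_ : IsProbabilityMeasure P)
        (ℱ : Filtration ℝ mΩ) (W y : ℝ → Ω → L2 D),
        FracSPDE.IsNormalFiltration P ℱ → FracSPDE.IsQWiener P ℱ Q T W →
        FracSPDE.IsSolution S mu s T y0 P ℱ W y →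
        ∃ Y : Ω × ℝ → FracSPDE.Hs S s,
          FracSPDE.IsL2HsRep S s (P.prod (volume.restrict (Icc 0 T)))
            (fun z => y z.2 z.1) Y ∧
          eLpNorm Y 2 (P.prod (volume.restrict (Icc 0 T))) ≤ ENNReal.ofReal C := by
  have hsum : Summable fun j => 3 / 2 * (S.lam j ^ s * inner ℝ y0 (S.e j) ^ 2)
      + 6 * T * (S.lam j ^ s * mu j) := by
    have h0 := (FracSPDE.mem_hsSubmodule_iff S (s / 2) y0).1 hy0
    rw [mul_div_cancel₀ s two_ne_zero] at h0
    exact (h0.mul_left _).add ((hdecay.summable_rpow_mul S).mul_left _)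
  have hnn : ∀ j, 0 ≤ 3 / 2 * (S.lam j ^ s * inner ℝ y0 (S.e j) ^ 2)
      + 6 * T * (S.lam j ^ s * mu j) := fun j => by
    have h1 := Real.rpow_nonneg (S.pos j).le s
    have h2 := hQ.nonneg j
    positivity
  -- The constant is fixed before the probability space is introduced; the `+ 1` keeps it positive
  -- when the series vanishes.
  refine ⟨√(∑' j, (3 / 2 * (S.lam j ^ s * inner ℝ y0 (S.e j) ^ 2)
      + 6 * T * (S.lam j ^ s * mu j))) + 1, by positivity, ?_⟩
  intro Ω mΩ P _ ℱ W y _ hW hy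
  have hmeas : ∀ j, AEMeasurable (fun z : Ω × ℝ => inner ℝ (y z.2 z.1) (S.e j))
      (P.prod (volume.restrict (Icc 0 T))) := fun j =>
    aemeasurable_prod_of_ae_continuousOn (X := fun t ω => inner ℝ (y t ω) (S.e j)) hT.le
      (fun t ht => (((hy.adapted t ht).mono (ℱ.le t)).inner stronglyMeasurable_const).measurable)
      ((hy.ito j).mono fun _ h => h.1)
  obtain ⟨Y, hY, hYn⟩ := FracSPDE.exists_isL2HsRep_of_tsum_lintegral_le S s
    (f := fun z : Ω × ℝ => y z.2 z.1) (tsum_nonneg hnn) hmeas (by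
      rw [ENNReal.ofReal_tsum_of_nonneg hnn hsum]
      exact ENNReal.tsum_le_tsum fun j => hy.lintegral_wcoord_sq_le hQ hT.le hW j (hmeas j))
  exact ⟨Y, hY, hYn.trans (ENNReal.ofReal_le_ofReal (by linarith))⟩
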